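/- Let $X$ be a real random variable with finite variance $\sigma_X^2$, mean $\mu=\mathbb E[X]$ and an absolutely continuous distribution. Let $\mathcal G$ be a connected, undirected, finite graph with vertex set $\mathcal V$ (the agents), and let $\mathcal N_i$ consist of $i$ and its neighbours. Let $x_{i,t}$ ($i\in\mathcal V$, $t\ge 1$) be independent copies of $X$. Let $0<\eta<1/16$, and let $\tilde x_{i,t}$ be random variables (chosen arbitrarily, possibly depending on all the $x_{j,s}$) such that almost surely, for every agent $i$ and every $t\ge1$, at most $\eta t$ of the indices $s\le t$ satisfy $\tilde x_{i,s}\ne x_{i,s}$. Let $t_0\ge 1$ and $\delta\in(0,1)$ be such that $\delta\ge 4e^{-(t-t_0)}$ for all $t\ge 2t_0$, and put $\epsilon=8\eta+12\frac{\log(4/\delta)}{t_0}$; assume $\epsilon<\frac12$. Fix an agent $o\in\mathcal V$, let $y_1^*\le\dots\le y_{t_0}^*$ be the non-decreasing rearrangement of $\tilde x_{o,1},\dots,\tilde x_{o,t_0}$, and set $\alpha=y_a^*$, $\beta=y_b^*$, where $a\le b$ are obtained from $\epsilon t_0$ and $(1-\epsilon)t_0$, respectively, by rounding to an integer (down or up).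 Let $\phi_{\alpha,\beta}(x)$ be $\beta$ if $x>\beta$, $x$ if $x\in[\alpha,\beta]$, and $\alpha$ if $x<\alpha$. Let $K\in\mathbb N=\{0,1,2,\dots\}$ be any number of communication rounds per time step. The estimates are defined by $\hat\mu^K_{i,t_0}=0$ and, for $t>t_0$, $$\hat\mu^0_{i,t}=\frac{(t-t_0-1)\,\hat\mu^K_{i,t-1}+\phi_{\alpha,\beta}(\tilde x_{i,t})}{t-t_0},\qquad \hat\mu^{k+1}_{i,t}=\frac1{|\mathcal N_i|}\sum_{j\in\mathcal N_i}\hat\mu^{k}_{j,t}\quad(k=0,\dots,K-1).$$ Then for every $\xi>0$ there is $\bar t$ such that for every $t\ge\bar t$, with probability at least $1-\delta$, all agents $i\in\mathcal V$ satisfy $$|\hat\mu^K_{i,t}-\mu|\le 24\,\sigma_X\sqrt{4\eta+6\,\frac{\log(4/\delta)}{t_0}}+\xi .$$ (In particular this holds for every $K$ with $c\lambda^K<1$, whatever the constants $c$ and $\lambda$ in the consensus rate of the averaging step are.) -/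

import Mathlib

open MeasureTheory ProbabilityTheory

noncomputable section

namespace RobustMean

/-- The trimming level `ε_t = 8η + 12 log(4/δ)/t`. -/
def trimLevel (η δ : ℝ) (t : ℕ) : ℝ := 8 * η + 12 * (Real.log (4 / δ) / t)

/-- The trim operator `φ_{α,β}` (used with `α ≤ β`). -/
def trim (α β x : ℝ) : ℝ := if β < x then β else if x < α then α else x

/-- The `k`-th term (`1 ≤ k ≤ n`) of the non-decreasing rearrangement of the data
`y 1, …, y n`; data streams are indexed by the times `1, 2, …`. -/
def orderStat (y : ℕ → ℝ) (n k : ℕ) : ℝ :=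
  let z : Fin n → ℝ := fun j => y (j + 1)
  if h : k - 1 < n then z (Tuple.sort z ⟨k - 1, h⟩) else 0

/-- `n` is obtained from the real number `r ≥ 0` by rounding it down or up. -/
def IsRounding (n : ℕ) (r : ℝ) : Prop := n = ⌊r⌋₊ ∨ n = ⌈r⌉₊

/-- `xt` is an `η`-corrupted version of the stream `x 1, x 2, …`: at every time `t ≥ 1` at most
`η t` of the first `t` data points differ from the original ones. -/
def IsCorruption (η : ℝ) (x xt : ℕ → ℝ) : Prop :=
  ∀ t : ℕ, 1 ≤ t → (((Finset.Icc 1 t).filter (fun j => xt j ≠ x j)).card : ℝ) ≤ η * t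

variable {V : Type*} [Fintype V] [DecidableEq V]

/-- The inclusive neighbourhood of the agent `i`. -/
def inclNeighbors (G : SimpleGraph V) [DecidableRel G.Adj] (i : V) : Finset V :=
  insert i (G.neighborFinset i)

/-- One round of communication: every agent averages the values in its inclusive
neighbourhood. -/
def averageRound (G : SimpleGraph V) [DecidableRel G.Adj] (v : V → ℝ) : V → ℝ :=
  fun i => (∑ j ∈ inclNeighbors G i, v j) / (inclNeighbors G i).card

/-- The distributed estimates with trimming values `α, β` fixed at time `t₀` and `K` rounds of
communication per time step, on the data `xt i t` of agent `i` at time `t`: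
`estimate G K t₀ α β xt t i` is the estimate of agent `i` at time `t` after the `K` rounds.
It is `0` up to time `t₀`; at each time `t > t₀` it is first updated locally by
`((t - t₀ - 1) * previous + φ_{α,β}(xt i t)) / (t - t₀)` and then averaged `K` times. -/
def estimate (G : SimpleGraph V) [DecidableRel G.Adj] (K t₀ : ℕ) (α β : ℝ)
    (xt : V → ℕ → ℝ) : ℕ → V → ℝ
  | 0 => fun _ => 0
  | t + 1 =>
    if t + 1 ≤ t₀ then fun _ => 0
    else (averageRound G)^[K] (fun i =>
      ((((t + 1 : ℕ) : ℝ) - t₀ - 1) * estimate G K t₀ α β xt t i + trim α β (xt i (t + 1))) /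
        (((t + 1 : ℕ) : ℝ) - t₀))

end RobustMean

end

/-! Everything is deterministic once two random ingredients are fixed. First, by Chernoff bounds for
the uncorrupted counts on four tails, with probability more than `1 - δ` the trimming values of
agent `o` have tail masses comparable to `ε`, whatever the adversary does (`exists_quantile_event`).
Then `α` and `β` lie at most `2σ/√ε` outside the mean, so trimming shifts the mean by at most
`10σ√ε` and `(β - α)ε ≤ 4σ√ε` (`bias_trim_le`). Second, `α` and `β` depend on the data, so the
strong law is proved almost surely for all levels at once (`ae_tendsto_average_trim`); no
independence of the levels from later data is needed. Corruption moves the limiting trimmed averages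
by at most `η(β - α)`. Communication costs nothing asymptotically. The sums `(t - t₀) * estimate`
keep a bounded spread over the agents (`exists_spread_bound`), and their degree-weighted total is
preserved by averaging. After division by `t - t₀` every agent is close to the weighted mean of the
local averages, all of which are close to the same number. Continuity from below turns this pathwise
statement into a single `tbar`; the strict inequality `1 - δ < P F` gives the room for it. -/

namespace RobustMean

/-! ### Averaging over a connected graph -/

section Consensus

variable {V : Type*} [Fintype V] [DecidableEq V] (G : SimpleGraph V) [DecidableRel G.Adj]

lemma mem_inclNeighbors {i j : V} : j ∈ inclNeighbors G i ↔ j = i ∨ G.Adj i j := by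
  simp [inclNeighbors]

lemma mem_inclNeighbors_comm {i j : V} : j ∈ inclNeighbors G i ↔ i ∈ inclNeighbors G j := by
  rw [mem_inclNeighbors, mem_inclNeighbors, G.adj_comm, eq_comm]

lemma card_inclNeighbors_pos (i : V) : 0 < ((inclNeighbors G i).card : ℝ) := by
  have : 0 < (inclNeighbors G i).card :=
    Finset.card_pos.2 ⟨i, (mem_inclNeighbors G).2 (Or.inl rfl)⟩
  exact_mod_cast this

/-- The averaging step as a linear map. -/
noncomputable def averageMap : Module.End ℝ (V → ℝ) where
  toFun := averageRound G
  map_add' v w := by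
    ext i; simp only [averageRound, Pi.add_apply, Finset.sum_add_distrib, add_div]
  map_smul' c v := by
    ext i; simp [averageRound, ← Finset.mul_sum, mul_div_assoc]

lemma averageMap_apply (v : V → ℝ) (i : V) :
    averageMap G v i = (∑ j ∈ inclNeighbors G i, v j) / (inclNeighbors G i).card := rfl

lemma averageRound_iterate (K : ℕ) (v : V → ℝ) :
    (averageRound G)^[K] v = (averageMap G ^ K) v := by
  rw [Module.End.pow_apply]; rfl

lemma averageMap_le {v : V → ℝ} {h : ℝ} (hv : ∀ i, v i ≤ h) (i : V) : averageMap G v i ≤ h := by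
  rw [averageMap_apply, div_le_iff₀ (card_inclNeighbors_pos G i), mul_comm, ← nsmul_eq_mul]
  exact Finset.sum_le_card_nsmul _ _ _ fun j _ => hv j

lemma averageMap_pow_le {v : V → ℝ} {h : ℝ} (hv : ∀ i, v i ≤ h) (n : ℕ) (i : V) :
    (averageMap G ^ n) v i ≤ h := by
  induction n generalizing i with
  | zero => simpa using hv i
  | succ n ih => rw [pow_succ']; exact averageMap_le G ih i

lemma le_averageMap_pow {v : V → ℝ} {l : ℝ} (hv : ∀ i, l ≤ v i) (n : ℕ) (i : V) :
    l ≤ (averageMap G ^ n) v i := by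
  have := averageMap_pow_le G (v := -v) (h := -l) (fun i => neg_le_neg (hv i)) n i
  rw [map_neg] at this
  exact neg_le_neg_iff.1 this

lemma averageMap_le_sub {v : V → ℝ} {h c : ℝ} (hc : 0 ≤ c) (hv : ∀ i, v i ≤ h) {i j : V}
    (hj : j ∈ inclNeighbors G i) (hvj : v j ≤ h - c) :
    averageMap G v i ≤ h - (Fintype.card V : ℝ)⁻¹ * c := by
  have hN := card_inclNeighbors_pos G i
  have hle : ((inclNeighbors G i).card : ℝ) ≤ Fintype.card V := by
    exact_mod_cast Finset.card_le_univ _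
  have h1 : ∑ k ∈ inclNeighbors G i, (h - v k) ≥ c :=
    le_trans (by linarith)
      (Finset.single_le_sum (f := fun k => h - v k) (fun k _ => by linarith [hv k]) hj)
  rw [Finset.sum_sub_distrib, Finset.sum_const, nsmul_eq_mul] at h1
  have h2 : (Fintype.card V : ℝ)⁻¹ * c ≤ c / (inclNeighbors G i).card := by
    rw [div_eq_inv_mul]; gcongr
  have h3 : averageMap G v i ≤ h - c / (inclNeighbors G i).card := by
    rw [averageMap_apply, le_sub_iff_add_le, ← add_div, div_le_iff₀ hN]
    linarith
  linarith

/-- Each averaging step along the walk passes on at least the fraction `1/|V|` of the deficit `h - v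
j`. -/
lemma averageMap_pow_le_sub_of_walk {v : V → ℝ} {h : ℝ} (hv : ∀ i, v i ≤ h) {i j : V}
    (p : G.Walk i j) :
    (averageMap G ^ p.length) v i ≤ h - ((Fintype.card V : ℝ)⁻¹) ^ p.length * (h - v j) := by
  induction p with
  | nil => simp
  | @cons i k j hik p ih =>
    rw [SimpleGraph.Walk.length_cons, pow_succ', pow_succ', mul_assoc]
    exact averageMap_le_sub G (by have := hv j; have : 0 ≤ h - v j := by linarith
                                  positivity) (averageMap_pow_le G hv _)
      ((mem_inclNeighbors G).2 (Or.inr hik)) ih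

/-- Each agent belongs to its own neighbourhood, so a deficit persists; this brings walks of
different lengths to a common exponent `n`. -/
lemma averageMap_pow_le_sub_of_le {v : V → ℝ} {h : ℝ} (hv : ∀ i, v i ≤ h) {i j : V} {m n : ℕ}
    (hm : (averageMap G ^ m) v i ≤ h - ((Fintype.card V : ℝ)⁻¹) ^ m * (h - v j)) (hmn : m ≤ n) :
    (averageMap G ^ n) v i ≤ h - ((Fintype.card V : ℝ)⁻¹) ^ n * (h - v j) := by
  induction n, hmn using Nat.le_induction with
  | base => exact hm
  | succ n _ ih =>
    rw [pow_succ', pow_succ', mul_assoc]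
    exact averageMap_le_sub G (by have := hv j; have : 0 ≤ h - v j := by linarith
                                  positivity) (averageMap_pow_le G hv _)
      ((mem_inclNeighbors G).2 (Or.inl rfl)) ih

variable {G}

/-- A path has length less than `|V|`, so after `n` steps every agent has felt the minimum of `v`,
while none has dropped below it. -/
lemma averageMap_pow_sub_le (hG : G.Connected) {v : V → ℝ} {B : ℝ}
    (hB : ∀ i j, v i - v j ≤ B) {n : ℕ} (hn : Fintype.card V ≤ n) (i j : V) :
    (averageMap G ^ n) v i - (averageMap G ^ n) v j
      ≤ (1 - ((Fintype.card V : ℝ)⁻¹) ^ n) * B := by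
  have := hG.nonempty
  obtain ⟨k, hk⟩ := Finite.exists_max v
  obtain ⟨l, hl⟩ := Finite.exists_min v
  obtain ⟨p, hp⟩ := hG.exists_isPath i l
  have h1 := averageMap_pow_le_sub_of_le G hk (averageMap_pow_le_sub_of_walk G hk p)
    (hp.length_lt.le.trans hn)
  have h2 := le_averageMap_pow G hl n j
  have hc : (1 : ℝ) ≤ Fintype.card V := by exact_mod_cast Fintype.card_pos
  have h3 : ((Fintype.card V : ℝ)⁻¹) ^ n ≤ 1 :=
    pow_le_one₀ (by positivity) (inv_le_one_of_one_le₀ hc)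
  have h4 := mul_le_mul_of_nonneg_left (hB k l) (sub_nonneg.2 h3)
  linarith

/-- Double counting of neighbouring pairs: the weights `|N_i|` are invariant because adjacency is
symmetric, although the averaging matrix need not be doubly stochastic. -/
lemma sum_card_mul_averageMap (v : V → ℝ) :
    ∑ i, ((inclNeighbors G i).card : ℝ) * averageMap G v i
      = ∑ i, ((inclNeighbors G i).card : ℝ) * v i := by
  have h1 : ∀ i, ((inclNeighbors G i).card : ℝ) * averageMap G v i
      = ∑ j ∈ inclNeighbors G i, v j := fun i => by
    rw [averageMap_apply, mul_div_cancel₀ _ (card_inclNeighbors_pos G i).ne']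
  simp_rw [h1]
  rw [Finset.sum_comm' (t' := Finset.univ) (s' := fun j => inclNeighbors G j)]
  · simp
  · intro i j
    simpa using mem_inclNeighbors_comm G

lemma sum_card_mul_averageMap_pow (v : V → ℝ) (n : ℕ) :
    ∑ i, ((inclNeighbors G i).card : ℝ) * (averageMap G ^ n) v i
      = ∑ i, ((inclNeighbors G i).card : ℝ) * v i := by
  induction n with
  | zero => simp
  | succ n ih => rw [pow_succ', Module.End.mul_apply, sum_card_mul_averageMap, ih]

/-- Unnormalized consensus iterates driven by inputs of bounded spread stay at bounded spread. -/
lemma exists_spread_bound (hG : G.Connected) {K : ℕ} (hK : 1 ≤ K) {D : ℝ}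
    {u v : ℕ → V → ℝ} (hu : ∀ n i j, u n i - u n j ≤ D) (hv0 : v 0 = 0)
    (hv : ∀ n, v (n + 1) = (averageMap G ^ K) (v n + u n)) :
    ∃ B : ℝ, ∀ n i j, v n i - v n j ≤ B := by
  have := hG.nonempty
  have hD : 0 ≤ D := by
    have i : V := Classical.arbitrary V
    simpa using hu 0 i i
  have spread : ∀ (n : ℕ) {w : V → ℝ} {B : ℝ}, (∀ i j, w i - w j ≤ B) →
      ∀ i j, (averageMap G ^ n) w i - (averageMap G ^ n) w j ≤ B := by
    intro n w B hw i j
    obtain ⟨l, hl⟩ := Finite.exists_min w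
    have h1 := averageMap_pow_le G (v := w) (h := w l + B) (fun i => by linarith [hw i l]) n i
    have h2 := le_averageMap_pow G hl n j
    linarith
  -- By linearity the difference collects only the `m` inputs since time `n`, each of spread at most
  -- `D`, and averaging does not increase spread.
  have step : ∀ n m : ℕ, ∀ i j, (v (n + m) i - (averageMap G ^ (K * m)) (v n) i)
      - (v (n + m) j - (averageMap G ^ (K * m)) (v n) j) ≤ m * D := by
    intro n m
    induction m with
    | zero => simp
    | succ m ih =>
      have key : v (n + (m + 1)) - (averageMap G ^ (K * (m + 1))) (v n)
          = (averageMap G ^ K) ((v (n + m) - (averageMap G ^ (K * m)) (v n)) + u (n + m)) := by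
        rw [← add_assoc, hv, mul_add, mul_one, add_comm (K * m), pow_add, Module.End.mul_apply,
          ← map_sub]
        congr 1
        abel
      have := spread K (w := (v (n + m) - (averageMap G ^ (K * m)) (v n)) + u (n + m))
        (B := (m + 1) * D) (fun i j => by
          have h1 := ih i j
          have h2 := hu (n + m) i j
          simp only [Pi.add_apply, Pi.sub_apply]
          linarith)
      rw [← key] at this
      simpa using this
  set m := Fintype.card V with hm
  have hmpos : 0 < m := Fintype.card_pos
  set c : ℝ := ((m : ℝ)⁻¹) ^ (K * m) with hc
  have hcpos : 0 < c := by positivity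
  have hc1 : c ≤ 1 := pow_le_one₀ (by positivity)
    (inv_le_one_of_one_le₀ (by exact_mod_cast hmpos))
  -- The fixed point of `B ↦ (1 - c) * B + m * D`, which bounds the effect of a block of `m` time
  -- steps.
  refine ⟨m * D / c, fun n => ?_⟩
  induction n using Nat.strong_induction_on with
  | _ n ih =>
    intro i j
    rcases lt_or_ge n m with hnm | hnm
    · have h1 := step 0 n i j
      simp only [hv0, map_zero, Pi.zero_apply, sub_zero, zero_add] at h1
      have h2 : (n : ℝ) * D ≤ m * D := by gcongr
      have h3 : (m : ℝ) * D ≤ m * D / c := le_div_self (by positivity) hcpos hc1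
      linarith
    · obtain ⟨k, rfl⟩ := Nat.exists_eq_add_of_le' hnm
      have h1 := step k m i j
      have h2 := averageMap_pow_sub_le hG (ih k (by omega)) (n := K * m)
        (by rw [← hm]; nlinarith) i j
      rw [← hm, ← hc] at h2
      have h3 : (1 - c) * (m * D / c) = m * D / c - m * D := by
        field_simp
      linarith

/-- If the time averages of the inputs of every agent are eventually `c`-close to `m`, then the
consensus estimates are eventually almost as close to `m`. -/
lemma consensus_eventually_close (hG : G.Connected) (K : ℕ) {D m c : ℝ} {u v : ℕ → V → ℝ}
    (hu : ∀ n i j, u n i - u n j ≤ D) (hv0 : v 0 = 0)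
    (hv : ∀ n, v (n + 1) = (averageMap G ^ K) (v n + u n))
    (hc : ∀ i, ∀ᶠ n : ℕ in Filter.atTop, |∑ s ∈ Finset.range n, u s i - n * m| ≤ n * c)
    {ξ : ℝ} (hξ : 0 < ξ) :
    ∀ᶠ n : ℕ in Filter.atTop, ∀ i, |v n i - n * m| ≤ n * (c + ξ) := by
  have := hG.nonempty
  have hc' := Filter.eventually_all.2 hc
  rcases Nat.eq_zero_or_pos K with rfl | hK
  · have hsum : ∀ n i, v n i = ∑ s ∈ Finset.range n, u s i := by
      intro n i
      induction n with
      | zero => simp [hv0]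
      | succ n ih => rw [hv, Finset.sum_range_succ, ← ih]; simp
    filter_upwards [hc'] with n hn i
    rw [hsum]
    have : 0 ≤ (n : ℝ) * ξ := by positivity
    linarith [hn i]
  · obtain ⟨B, hB⟩ := exists_spread_bound hG hK hu hv0 hv
    obtain ⟨N, hN⟩ := exists_nat_gt (B / ξ)
    filter_upwards [hc', Filter.eventually_ge_atTop N] with n hn hNn i
    have hBn : B ≤ n * ξ := by
      have : (N : ℝ) ≤ n := by exact_mod_cast hNn
      rw [div_lt_iff₀ hξ] at hN
      nlinarith
    set w : V → ℝ := fun i => ((inclNeighbors G i).card : ℝ) with hw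
    have hwpos : ∀ i, 0 < w i := card_inclNeighbors_pos G
    have hT : 0 < ∑ j, w j := Finset.sum_pos (fun j _ => hwpos j) Finset.univ_nonempty
    have hL : ∀ n, ∑ j, w j * v n j = ∑ j, w j * ∑ s ∈ Finset.range n, u s j := by
      intro n
      induction n with
      | zero => simp [hv0]
      | succ n ih =>
        rw [hv, sum_card_mul_averageMap_pow]
        simp only [Pi.add_apply, mul_add, Finset.sum_add_distrib, Finset.sum_range_succ]
        rw [← ih]
    have e : (∑ j, w j) * (v n i - n * m)
        = ∑ j, w j * (v n i - v n j) + ∑ j, w j * (∑ s ∈ Finset.range n, u s j - n * m) := by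
      simp only [mul_sub, Finset.sum_sub_distrib, hL, Finset.sum_mul]
      ring
    have hb : |(∑ j, w j) * (v n i - n * m)| ≤ (∑ j, w j) * (n * (c + ξ)) := by
      rw [e, ← Finset.sum_add_distrib, Finset.sum_mul]
      refine (Finset.abs_sum_le_sum_abs _ _).trans (Finset.sum_le_sum fun j _ => ?_)
      rw [← mul_add, abs_mul, abs_of_pos (hwpos j)]
      refine mul_le_mul_of_nonneg_left ?_ (hwpos j).le
      have h1 : |v n i - v n j| ≤ B := abs_le.2 ⟨by linarith [hB n j i], hB n i j⟩
      refine (abs_add_le _ _).trans ?_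
      linarith [hn j]
    rw [abs_mul, abs_of_pos hT] at hb
    exact le_of_mul_le_mul_left hb hT

/-- Multiplication by the elapsed time removes the time-dependent weights and leaves the linear
recursion of `consensus_eventually_close`. -/
lemma smul_estimate_succ (K t₀ : ℕ) (α β : ℝ) (xt : V → ℕ → ℝ) (n : ℕ) :
    ((n + 1 : ℕ) : ℝ) • estimate G K t₀ α β xt (t₀ + (n + 1))
      = (averageMap G ^ K) ((n : ℝ) • estimate G K t₀ α β xt (t₀ + n)
          + fun i => trim α β (xt i (t₀ + n + 1))) := by
  rw [← add_assoc, estimate, if_neg (by omega), averageRound_iterate, ← map_smul]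
  congr 1
  ext i
  have h : (((t₀ + n + 1 : ℕ) : ℝ) - t₀) = n + 1 := by push_cast; ring
  simp only [Pi.smul_apply, smul_eq_mul, Pi.add_apply, h]
  have : (n : ℝ) + 1 ≠ 0 := by positivity
  push_cast
  field_simp
  ring

end Consensus

/-! ### The trim operator as a clamp -/

section Trim

lemma trim_eq_max_min {α β : ℝ} (h : α ≤ β) (x : ℝ) : trim α β x = max α (min β x) := by
  unfold trim
  split_ifs with h1 h2
  · rw [min_eq_left h1.le, max_eq_right h]
  · rw [min_eq_right (not_lt.1 h1), max_eq_left h2.le]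
  · rw [min_eq_right (not_lt.1 h1), max_eq_right (not_lt.1 h2)]

lemma abs_max_min_sub_le (α β α' β' x : ℝ) :
    |max α (min β x) - max α' (min β' x)| ≤ max |α - α'| |β - β'| := by
  refine (abs_max_sub_max_le_max _ _ _ _).trans (max_le_max le_rfl ?_)
  refine (abs_min_sub_min_le_max _ _ _ _).trans ?_
  simp

lemma le_trim {α β : ℝ} (h : α ≤ β) (x : ℝ) : α ≤ trim α β x := by
  rw [trim_eq_max_min h]; exact le_max_left _ _

lemma trim_le {α β : ℝ} (h : α ≤ β) (x : ℝ) : trim α β x ≤ β := by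
  rw [trim_eq_max_min h]; exact max_le h (min_le_left _ _)

lemma abs_sum_trim_sub_le {α β η : ℝ} (h : α ≤ β) {x xt : ℕ → ℝ} (hc : IsCorruption η x xt)
    (t₀ n : ℕ) (hn : 1 ≤ t₀ + n) :
    |∑ s ∈ Finset.range n, trim α β (xt (t₀ + s + 1)) -
      ∑ s ∈ Finset.range n, trim α β (x (t₀ + s + 1))| ≤ (β - α) * (η * ((t₀ + n : ℕ) : ℝ)) := by
  rw [← Finset.sum_sub_distrib]
  refine (Finset.abs_sum_le_sum_abs _ _).trans ?_
  have h1 : ∀ s ∈ Finset.range n,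
      |trim α β (xt (t₀ + s + 1)) - trim α β (x (t₀ + s + 1))|
        ≤ if xt (t₀ + s + 1) ≠ x (t₀ + s + 1) then β - α else 0 := by
    intro s _
    split_ifs with hs
    · rw [abs_le]
      constructor <;> linarith [le_trim h (xt (t₀ + s + 1)), le_trim h (x (t₀ + s + 1)),
        trim_le h (xt (t₀ + s + 1)), trim_le h (x (t₀ + s + 1))]
    · rw [not_not.1 hs]; simp
  refine (Finset.sum_le_sum h1).trans ?_
  rw [← Finset.sum_filter, Finset.sum_const, nsmul_eq_mul, mul_comm]
  refine mul_le_mul_of_nonneg_left (le_trans ?_ (hc (t₀ + n) hn)) (by linarith)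
  norm_cast
  refine Finset.card_le_card_of_injOn (fun s => t₀ + s + 1) ?_ (fun a _ b _ hab => by
    simp only at hab; omega)
  intro s hs
  simp only [Finset.coe_filter, Finset.mem_range, Set.mem_ofPred_eq, Finset.mem_Icc] at hs ⊢
  exact ⟨by omega, hs.2⟩

end Trim

/-! ### Order statistics and sample counts -/

section OrderStat

/-- Turns order statistics into counts, on which the effect of corruption is additive. -/
lemma orderStat_le_iff (y : ℕ → ℝ) {n k : ℕ} (hk : 1 ≤ k) (hkn : k ≤ n) (q : ℝ) :
    orderStat y n k ≤ q ↔ k ≤ ((Finset.Icc 1 n).filter (fun s => y s ≤ q)).card := by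
  have h : k - 1 < n := by omega
  set z : Fin n → ℝ := fun j => y (j + 1) with hz
  have e : orderStat y n k = z (Tuple.sort z ⟨k - 1, h⟩) := by
    simp only [orderStat, dif_pos h, hz]
  have h1 := Tuple.lt_card_le_iff_apply_le_of_monotone (f := z ∘ Tuple.sort z) (a := q)
    (j := ⟨k - 1, h⟩) (Tuple.monotone_sort z)
  rw [e]
  change (z ∘ Tuple.sort z) ⟨k - 1, h⟩ ≤ q ↔ _
  rw [← h1]
  have h2 : (Finset.univ.filter (fun i => (z ∘ Tuple.sort z) i ≤ q)).card
      = ((Finset.Icc 1 n).filter (fun s => y s ≤ q)).card := by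
    refine Finset.card_bij (fun i _ => (Tuple.sort z i : ℕ) + 1) ?_ ?_ ?_
    · intro i hi
      simp only [Finset.mem_filter, Finset.mem_univ, true_and, Function.comp, hz] at hi
      simp only [Finset.mem_filter, Finset.mem_Icc]
      exact ⟨by omega, hi⟩
    · intro i _ j _ hij
      have : Tuple.sort z i = Tuple.sort z j := Fin.ext (by omega)
      exact (Tuple.sort z).injective this
    · intro s hs
      simp only [Finset.mem_filter, Finset.mem_Icc] at hs
      refine ⟨(Tuple.sort z).symm ⟨s - 1, by omega⟩, ?_, ?_⟩
      · simp only [Finset.mem_filter, Finset.mem_univ, true_and, Function.comp, hz,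
          Equiv.apply_symm_apply, Nat.sub_add_cancel hs.1.1]
        exact hs.2
      · simp only [Equiv.apply_symm_apply]; omega
  have h3 : k - 1 < (Finset.univ.filter (fun i => (z ∘ Tuple.sort z) i ≤ q)).card
      ↔ k ≤ ((Finset.Icc 1 n).filter (fun s => y s ≤ q)).card := by rw [h2]; omega
  exact h3

lemma orderStat_mono (y : ℕ → ℝ) {n k l : ℕ} (hk : 1 ≤ k) (hkl : k ≤ l) (hl : l ≤ n) :
    orderStat y n k ≤ orderStat y n l := by
  rw [orderStat_le_iff y hk (hkl.trans hl)]
  exact hkl.trans ((orderStat_le_iff y (hk.trans hkl) hl _).1 le_rfl)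

open Classical in
/-- The number of the data `y 1, …, y n` that lie in `S`. -/
noncomputable def sampleCount (y : ℕ → ℝ) (n : ℕ) (S : Set ℝ) : ℝ :=
  ((Finset.Icc 1 n).filter (fun s => y s ∈ S)).card

lemma sampleCount_Iic (y : ℕ → ℝ) (n : ℕ) (q : ℝ) :
    sampleCount y n (Set.Iic q) = ((Finset.Icc 1 n).filter (fun s => y s ≤ q)).card := by
  simp only [sampleCount, Set.mem_Iic]

lemma sampleCount_eq_sum_indicator (y : ℕ → ℝ) (n : ℕ) (S : Set ℝ) :
    sampleCount y n S = ∑ s ∈ Finset.range n, S.indicator (1 : ℝ → ℝ) (y (s + 1)) := by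
  classical
  rw [sampleCount, Finset.card_filter, Finset.range_eq_Ico, Finset.sum_Ico_add' (fun s =>
    S.indicator (1 : ℝ → ℝ) (y s)) 0 n 1]
  push_cast
  refine Finset.sum_congr (by ext; simp) fun s _ => ?_
  simp [Set.indicator_apply]

lemma sampleCount_Iic_add_Ioi (y : ℕ → ℝ) (n : ℕ) (q : ℝ) :
    sampleCount y n (Set.Iic q) + sampleCount y n (Set.Ioi q) = n := by
  rw [sampleCount_eq_sum_indicator, sampleCount_eq_sum_indicator, ← Finset.sum_add_distrib]
  have h : ∀ z : ℝ, (Set.Iic q).indicator (1 : ℝ → ℝ) z + (Set.Ioi q).indicator 1 z = 1 := by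
    intro z
    rcases le_or_gt z q with h | h <;> simp [h, not_lt_of_ge, not_le_of_gt]
  simp only [h, Finset.sum_const, Finset.card_range, nsmul_eq_mul, mul_one]

lemma IsCorruption.sampleCount_le {η : ℝ} {x xt : ℕ → ℝ} (hc : IsCorruption η x xt) {n : ℕ}
    (hn : 1 ≤ n) (S : Set ℝ) : sampleCount xt n S ≤ sampleCount x n S + η * n := by
  classical
  refine le_trans ?_ (add_le_add_right (hc n hn) _)
  unfold sampleCount
  norm_cast
  refine (Finset.card_le_card ?_).trans (Finset.card_union_le _ _)
  intro s hs
  simp only [Finset.mem_filter, Finset.mem_union] at hs ⊢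
  by_cases h : xt s = x s
  · exact Or.inl ⟨hs.1, h ▸ hs.2⟩
  · exact Or.inr ⟨hs.1, h⟩

lemma IsCorruption.symm {η : ℝ} {x xt : ℕ → ℝ} (hc : IsCorruption η x xt) :
    IsCorruption η xt x := by
  intro t ht
  simpa only [ne_comm] using hc t ht

end OrderStat

/-! ### Quantiles and the bias of trimming -/

section Law

lemma exists_measureReal_Iic_eq (ν : Measure ℝ) [IsProbabilityMeasure ν] (hν : ν ≪ volume) {p : ℝ}
    (hp0 : 0 < p) (hp1 : p < 1) : ∃ q, ν.real (Set.Iic q) = p := by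
  have hc : Continuous (cdf ν) := by
    rw [continuous_iff_continuousAt]
    intro x
    rw [(cdf ν).mono.continuousAt_iff_leftLim_eq_rightLim, (cdf ν).rightLim_eq]
    have h1 : (cdf ν).measure {x} = 0 := by
      rw [measure_cdf]; exact hν (measure_singleton x)
    rw [StieltjesFunction.measure_singleton, ENNReal.ofReal_eq_zero] at h1
    have h2 := (cdf ν).mono.leftLim_le (le_refl x)
    linarith
  have h0 := ((tendsto_cdf_atBot ν).eventually (gt_mem_nhds hp0)).exists
  have h1 := ((tendsto_cdf_atTop ν).eventually (lt_mem_nhds hp1)).exists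
  obtain ⟨u, hu⟩ := h0
  obtain ⟨v, hv⟩ := h1
  obtain ⟨q, hq⟩ := mem_range_of_exists_le_of_exists_ge hc ⟨u, hu.le⟩ ⟨v, hv.le⟩
  exact ⟨q, by rw [← cdf_eq_real]; exact hq⟩

variable {Ω₀ : Type*} [MeasurableSpace Ω₀] {P₀ : Measure Ω₀} [IsProbabilityMeasure P₀] {X : Ω₀ → ℝ}

/-- A set of probability at least `r` on which `|X - μ| ≥ d` forces `d² r ≤ Var X`. -/
lemma sq_mul_le_variance (hX : MemLp X 2 P₀) {S : Set ℝ} {d r : ℝ} (hd : 0 ≤ d)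
    (hr : r ≤ (P₀.map X).real S) (hS : MeasurableSet S)
    (h : ∀ x ∈ S, d ≤ |x - ∫ ω, X ω ∂P₀|) : d ^ 2 * r ≤ variance X P₀ := by
  have hXm := hX.aestronglyMeasurable.aemeasurable
  rw [variance_eq_integral hXm]
  have hint : Integrable (fun ω => (X ω - ∫ ω, X ω ∂P₀) ^ 2) P₀ :=
    (hX.sub (memLp_const _)).integrable_sq
  have h1 := mul_meas_ge_le_integral_of_nonneg (Filter.Eventually.of_forall fun ω => sq_nonneg _)
    hint (d ^ 2)
  refine le_trans (mul_le_mul_of_nonneg_left (hr.trans ?_) (sq_nonneg d)) h1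
  rw [map_measureReal_apply_of_aemeasurable hXm hS]
  refine measureReal_mono fun ω hω => ?_
  have := h _ hω
  exact (sq_le_sq₀ hd (abs_nonneg _)).2 this |>.trans_eq (sq_abs _)

/-- The bias of trimming at levels whose tails are comparable to `ε`. -/
lemma bias_trim_le_of_variance_le (hX : MemLp X 2 P₀) {α β ε τ : ℝ} (hαβ : α ≤ β) (hε : 0 < ε)
    (hτ : 0 < τ) (hvar : variance X P₀ ≤ τ ^ 2)
    (h1 : ε / 4 ≤ (P₀.map X).real (Set.Iic α)) (h2 : (P₀.map X).real (Set.Iio α) ≤ 2 * ε)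
    (h3 : ε / 4 ≤ (P₀.map X).real (Set.Ici β)) (h4 : (P₀.map X).real (Set.Ioi β) ≤ 2 * ε) :
    |∫ ω, trim α β (X ω) ∂P₀ - ∫ ω, X ω ∂P₀| ≤ 10 * τ * √ε ∧ (β - α) * ε ≤ 4 * τ * √ε := by
  have hXm := hX.aestronglyMeasurable.aemeasurable
  set μ := ∫ ω, X ω ∂P₀ with hμ
  set r := √ε with hr
  have hrpos : 0 < r := Real.sqrt_pos.2 hε
  have hr2 : r ^ 2 = ε := Real.sq_sqrt hε.le
  set s := 2 * τ / r with hs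
  have hspos : 0 < s := by positivity
  have hsr : s * r = 2 * τ := by rw [hs]; field_simp
  -- Chebyshev with tail mass `ε / 4`: this is where `s = 2τ/√ε` comes from.
  have key : ∀ d : ℝ, 0 ≤ d → d ^ 2 * (ε / 4) ≤ variance X P₀ → d ≤ s := by
    intro d hd h
    rw [hs, le_div_iff₀ hrpos]
    refine le_of_sq_le_sq (a := d * r) ?_ (by positivity)
    nlinarith
  have hα : μ - α ≤ s := by
    rcases le_or_gt μ α with h | h
    · linarith
    · refine key _ (by linarith) (sq_mul_le_variance hX (by linarith) h1 measurableSet_Iic ?_)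
      intro x hx
      have : x ≤ α := hx
      rw [← hμ, abs_sub_comm]
      exact (by linarith : μ - α ≤ μ - x).trans (le_abs_self _)
  have hβ : β - μ ≤ s := by
    rcases le_or_gt β μ with h | h
    · linarith
    · refine key _ (by linarith) (sq_mul_le_variance hX (by linarith) h3 measurableSet_Ici ?_)
      intro x hx
      have : β ≤ x := hx
      rw [← hμ]
      exact (by linarith : β - μ ≤ x - μ).trans (le_abs_self _)
  have hsε : s * ε = 2 * τ * r := by rw [← hr2, ← hsr]; ring
  refine ⟨?_, by nlinarith⟩
  have htrim : ∀ x, |trim α β x - μ| ≤ s := fun x =>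
    abs_le.2 ⟨by linarith [le_trim hαβ x], by linarith [trim_le hαβ x]⟩
  set A : Set ℝ := Set.Iio α ∪ Set.Ioi β with hA
  have hAm : MeasurableSet A := measurableSet_Iio.union measurableSet_Ioi
  have hAp : (P₀.map X).real A ≤ 4 * ε := (measureReal_union_le _ _).trans (by linarith)
  have htm : Measurable (trim α β) := by
    have : trim α β = fun x => max α (min β x) := funext fun x => trim_eq_max_min hαβ x
    rw [this]; fun_prop
  have hXi : Integrable X P₀ := hX.integrable (by norm_num)
  have hti : Integrable (fun ω => trim α β (X ω)) P₀ := by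
    refine Integrable.of_bound (htm.comp_aemeasurable hXm).aestronglyMeasurable (s + |μ|)
      (Filter.Eventually.of_forall fun ω => ?_)
    have := htrim (X ω)
    rw [Real.norm_eq_abs]
    have h := abs_add_le (trim α β (X ω) - μ) μ
    rw [sub_add_cancel] at h
    linarith
  have hsq : Integrable (fun ω => (X ω - μ) ^ 2) P₀ := (hX.sub (memLp_const _)).integrable_sq
  have hind : Integrable (fun ω => A.indicator (1 : ℝ → ℝ) (X ω)) P₀ := by
    refine Integrable.of_bound ((measurable_one.indicator hAm).comp_aemeasurable
      hXm).aestronglyMeasurable 1 (Filter.Eventually.of_forall fun ω => ?_)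
    by_cases h : X ω ∈ A <;> simp [h]
  have hindv : ∫ ω, A.indicator (1 : ℝ → ℝ) (X ω) ∂P₀ = (P₀.map X).real A := by
    rw [← integral_indicator_one hAm, integral_map hXm
      (measurable_one.indicator hAm).aestronglyMeasurable]
  -- pointwise AM-GM
  set c := τ / (2 * r) with hc
  have hcpos : 0 < c := by positivity
  have hpt : ∀ ω, |trim α β (X ω) - X ω|
      ≤ (X ω - μ) ^ 2 * (1 / (2 * c)) + (s + c / 2) * A.indicator (1 : ℝ → ℝ) (X ω) := by
    intro ω
    by_cases h : X ω ∈ A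
    · rw [Set.indicator_of_mem h, Pi.one_apply, mul_one]
      have e1 : |trim α β (X ω) - X ω| ≤ s + |X ω - μ| := by
        have := abs_sub_le (trim α β (X ω)) μ (X ω)
        rw [abs_sub_comm μ] at this
        linarith [htrim (X ω)]
      have e2 : |X ω - μ| ≤ (X ω - μ) ^ 2 * (1 / (2 * c)) + c / 2 := by
        rw [← sq_abs, ← sub_nonneg]
        have : |X ω - μ| ^ 2 * (1 / (2 * c)) + c / 2 - |X ω - μ|
            = (|X ω - μ| - c) ^ 2 / (2 * c) := by field_simp; ring
        rw [this]; positivity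
      linarith
    · rw [Set.indicator_of_notMem h, mul_zero, add_zero]
      have e : trim α β (X ω) = X ω := by
        simp only [hA, Set.mem_union, Set.mem_Iio, Set.mem_Ioi, not_or, not_lt] at h
        rw [trim_eq_max_min hαβ, min_eq_right h.2, max_eq_right h.1]
      rw [e, sub_self, abs_zero]
      positivity
  rw [← integral_sub hti hXi]
  refine abs_integral_le_integral_abs.trans ((integral_mono (hti.sub hXi).abs
    ((hsq.mul_const _).add (hind.const_mul _)) hpt).trans ?_)
  have hi := integral_add (hsq.mul_const (1 / (2 * c))) (hind.const_mul (s + c / 2))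
  simp only [Pi.add_apply] at hi ⊢
  rw [hi, integral_mul_const, integral_const_mul, hindv, ← variance_eq_integral hXm]
  have f1 : variance X P₀ * (1 / (2 * c)) ≤ τ ^ 2 * (1 / (2 * c)) := by gcongr
  have f2 : τ ^ 2 * (1 / (2 * c)) = τ * r := by rw [hc]; field_simp
  have f3 : (s + c / 2) * (P₀.map X).real A ≤ (s + c / 2) * (4 * ε) := by gcongr
  have f4 : c * ε = τ * r / 2 := by rw [hc, ← hr2]; field_simp
  nlinarith

/-- Letting `τ` decrease to the standard deviation covers zero variance too, where the division by
`c` would fail. -/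
lemma bias_trim_le (hX : MemLp X 2 P₀) {α β ε : ℝ} (hαβ : α ≤ β) (hε : 0 < ε)
    (h1 : ε / 4 ≤ (P₀.map X).real (Set.Iic α)) (h2 : (P₀.map X).real (Set.Iio α) ≤ 2 * ε)
    (h3 : ε / 4 ≤ (P₀.map X).real (Set.Ici β)) (h4 : (P₀.map X).real (Set.Ioi β) ≤ 2 * ε) :
    |∫ ω, trim α β (X ω) ∂P₀ - ∫ ω, X ω ∂P₀| ≤ 10 * √(variance X P₀) * √ε ∧
      (β - α) * ε ≤ 4 * √(variance X P₀) * √ε := by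
  have hv := variance_nonneg X P₀
  have hlim : Filter.Tendsto (fun τ : ℝ => τ) (nhdsWithin (√(variance X P₀))
      (Set.Ioi (√(variance X P₀))))
      (nhds (√(variance X P₀))) := tendsto_nhdsWithin_of_tendsto_nhds Filter.tendsto_id
  have hall : ∀ τ ∈ Set.Ioi (√(variance X P₀)),
      |∫ ω, trim α β (X ω) ∂P₀ - ∫ ω, X ω ∂P₀| ≤ 10 * τ * √ε ∧ (β - α) * ε ≤ 4 * τ * √ε := by
    intro τ hτ
    have hτ' : √(variance X P₀) < τ := hτ
    have h0 : 0 < τ := (Real.sqrt_nonneg _).trans_lt hτ'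
    exact bias_trim_le_of_variance_le hX hαβ hε h0 ((Real.sqrt_lt_sqrt_iff hv).1 (by
      rwa [Real.sqrt_sq h0.le])).le h1 h2 h3 h4
  constructor
  · exact ge_of_tendsto ((hlim.const_mul 10).mul_const _)
      (eventually_nhdsWithin_of_forall fun τ hτ => (hall τ hτ).1)
  · exact ge_of_tendsto ((hlim.const_mul 4).mul_const _)
      (eventually_nhdsWithin_of_forall fun τ hτ => (hall τ hτ).2)

end Law

/-! ### Chernoff bounds for sample counts -/

section Chernoff

variable {Ω : Type*} [MeasurableSpace Ω] {P : Measure Ω} [IsProbabilityMeasure P]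
  {Y : ℕ → Ω → ℝ} {ν : Measure ℝ} {A : Set ℝ}

lemma integrable_exp_sum_indicator (hY : ∀ s, AEMeasurable (Y s) P) (hA : MeasurableSet A)
    (t : ℝ) (N : ℕ) :
    Integrable (fun ω => Real.exp
      (t * (∑ s ∈ Finset.range N, fun ω => A.indicator (1 : ℝ → ℝ) (Y s ω)) ω)) P := by
  have hm : AEMeasurable (fun ω => Real.exp
      (t * (∑ s ∈ Finset.range N, fun ω => A.indicator (1 : ℝ → ℝ) (Y s ω)) ω)) P := by
    have : ∀ s, AEMeasurable (fun ω => A.indicator (1 : ℝ → ℝ) (Y s ω)) P := fun s =>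
      (measurable_one.indicator hA).comp_aemeasurable (hY s)
    exact Real.measurable_exp.comp_aemeasurable
      ((Finset.aemeasurable_sum _ fun s _ => this s).const_mul t)
  refine Integrable.of_bound hm.aestronglyMeasurable (Real.exp (|t| * N))
    (Filter.Eventually.of_forall fun ω => ?_)
  rw [Real.norm_eq_abs, Real.abs_exp, Real.exp_le_exp, Finset.sum_apply]
  have h0 : ∀ s, 0 ≤ A.indicator (1 : ℝ → ℝ) (Y s ω) ∧ A.indicator (1 : ℝ → ℝ) (Y s ω) ≤ 1 := by
    intro s
    by_cases h : Y s ω ∈ A <;> simp [h]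
  have h1 : ∑ s ∈ Finset.range N, A.indicator (1 : ℝ → ℝ) (Y s ω) ≤ N := by
    simpa using Finset.sum_le_sum (s := Finset.range N) fun s _ => (h0 s).2
  have h2 : 0 ≤ ∑ s ∈ Finset.range N, A.indicator (1 : ℝ → ℝ) (Y s ω) :=
    Finset.sum_nonneg fun s _ => (h0 s).1
  exact (mul_le_mul_of_nonneg_right (le_abs_self t) h2).trans
    (mul_le_mul_of_nonneg_left h1 (abs_nonneg t))

/-- For an indicator, `exp (t * 1_A) = 1 + 1_A * (exp t - 1)`; then `1 + u ≤ exp u` is applied to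
each factor. -/
lemma mgf_sum_indicator_le (hY : ∀ s, AEMeasurable (Y s) P) (hind : iIndepFun Y P)
    (hlaw : ∀ s, P.map (Y s) = ν) (hA : MeasurableSet A) (t : ℝ) (N : ℕ) :
    mgf (∑ s ∈ Finset.range N, fun ω => A.indicator (1 : ℝ → ℝ) (Y s ω)) P t
      ≤ Real.exp (N * (ν.real A * (Real.exp t - 1))) := by
  have him : Measurable (A.indicator (1 : ℝ → ℝ)) := measurable_one.indicator hA
  have hind' : iIndepFun (fun s ω => A.indicator (1 : ℝ → ℝ) (Y s ω)) P :=
    hind.comp (fun _ => A.indicator (1 : ℝ → ℝ)) fun _ => him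
  rw [hind'.mgf_sum₀ fun s => him.comp_aemeasurable (hY s)]
  have h1 : ∀ s ∈ Finset.range N, mgf (fun ω => A.indicator (1 : ℝ → ℝ) (Y s ω)) P t
      ≤ Real.exp (ν.real A * (Real.exp t - 1)) := by
    intro s _
    have hi : Integrable (fun ω => A.indicator (1 : ℝ → ℝ) (Y s ω)) P :=
      Integrable.of_bound (him.comp_aemeasurable (hY s)).aestronglyMeasurable 1
        (Filter.Eventually.of_forall fun ω => by by_cases h : Y s ω ∈ A <;> simp [h])
    have hv : ∫ ω, A.indicator (1 : ℝ → ℝ) (Y s ω) ∂P = ν.real A := by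
      rw [← hlaw s, ← integral_indicator_one hA, integral_map (hY s) him.aestronglyMeasurable]
    have e : (fun ω => Real.exp (t * A.indicator (1 : ℝ → ℝ) (Y s ω)))
        = fun ω => 1 + A.indicator (1 : ℝ → ℝ) (Y s ω) * (Real.exp t - 1) := by
      ext ω
      by_cases h : Y s ω ∈ A <;> simp [h]
    rw [mgf, e, integral_add (integrable_const _) (hi.mul_const _), integral_mul_const, hv]
    simp only [integral_const, probReal_univ, smul_eq_mul, mul_one]
    rw [add_comm]
    exact Real.add_one_le_exp _
  refine (Finset.prod_le_prod (fun s _ => mgf_nonneg) h1).trans_eq ?_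
  rw [Finset.prod_const, Finset.card_range, ← Real.exp_nat_mul]

variable {x : ℕ → Ω → ℝ}

lemma measureReal_le_sampleCount_le (hx : ∀ s, AEMeasurable (x (s + 1)) P)
    (hind : iIndepFun (fun s => x (s + 1)) P) (hlaw : ∀ s, P.map (x (s + 1)) = ν)
    (hA : MeasurableSet A) (N : ℕ) {p : ℝ} (hp : 0 ≤ p) (hν : ν.real A = p / 4) :
    P.real {ω | 13 / 16 * (p * N) ≤ sampleCount (fun s => x s ω) N A}
      ≤ Real.exp (-(p * N) / 12) := by
  have h := measure_ge_le_exp_mul_mgf (μ := P) (13 / 16 * (p * N)) (zero_le_one' ℝ)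
    (integrable_exp_sum_indicator hx hA 1 N)
  have h2 := mgf_sum_indicator_le hx hind hlaw hA 1 N
  simp only [Finset.sum_apply] at h
  simp only [sampleCount_eq_sum_indicator]
  refine h.trans ((mul_le_mul_of_nonneg_left h2 (Real.exp_pos _).le).trans ?_)
  rw [← Real.exp_add, Real.exp_le_exp, hν]
  have := Real.exp_one_lt_d9
  have h3 : 0 ≤ p * N := by positivity
  -- The exponent is `(-13/16 + (e - 1)/4) * (p * N)`, well below `-(p * N)/12`.
  nlinarith

lemma measureReal_sampleCount_le_le (hx : ∀ s, AEMeasurable (x (s + 1)) P)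
    (hind : iIndepFun (fun s => x (s + 1)) P) (hlaw : ∀ s, P.map (x (s + 1)) = ν)
    (hA : MeasurableSet A) (N : ℕ) {p : ℝ} (hp : 0 ≤ p) (hν : ν.real A = 2 * p) :
    P.real {ω | sampleCount (fun s => x s ω) N A ≤ 19 / 16 * (p * N)}
      ≤ Real.exp (-(p * N) / 12) := by
  have h := measure_le_le_exp_mul_mgf (μ := P) (t := -(1 / 2)) (19 / 16 * (p * N)) (by norm_num)
    (integrable_exp_sum_indicator hx hA _ N)
  have h2 := mgf_sum_indicator_le hx hind hlaw hA (-(1 / 2)) N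
  simp only [Finset.sum_apply] at h
  simp only [sampleCount_eq_sum_indicator]
  refine h.trans ((mul_le_mul_of_nonneg_left h2 (Real.exp_pos _).le).trans ?_)
  rw [← Real.exp_add, Real.exp_le_exp, hν]
  -- With this bound the exponent is at most `(19/32 - 7/10) * (p * N)`, which is below `-(p *
  -- N)/12`.
  have h4 : Real.exp (-(1 / 2)) ≤ 13 / 20 := by
    have h5 : Real.exp (-(1 / 2)) ^ 2 = Real.exp (-1) := by
      rw [← Real.exp_nat_mul]; norm_num
    have h6 := Real.exp_neg_one_lt_d9
    exact le_of_sq_le_sq (a := Real.exp (-(1 / 2))) (by rw [h5]; linarith) (by norm_num)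
  have h3 : 0 ≤ p * N := by positivity
  nlinarith

end Chernoff

/-! ### A strong law uniform in the trimming levels -/

section StrongLaw

open Filter Topology

lemma measurable_clamp (α β : ℝ) : Measurable (fun x : ℝ => max α (min β x)) := by fun_prop

lemma integrable_clamp {Ω : Type*} [MeasurableSpace Ω] {P : Measure Ω} [IsProbabilityMeasure P]
    {X : Ω → ℝ} (hX : AEMeasurable X P) (α β : ℝ) :
    Integrable (fun ω => max α (min β (X ω))) P := by
  refine Integrable.of_bound ((measurable_clamp α β).comp_aemeasurable hX).aestronglyMeasurable
    (|α| + |β|) (Filter.Eventually.of_forall fun ω => ?_)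
  rw [Real.norm_eq_abs, abs_le]
  constructor
  · linarith [le_max_left α (min β (X ω)), neg_abs_le α, abs_nonneg β]
  · refine max_le ?_ ((min_le_left _ _).trans ?_)
    · linarith [le_abs_self α, abs_nonneg β]
    · linarith [le_abs_self β, abs_nonneg α]

/-- The strong law of large numbers, simultaneously for all truncation levels. -/
lemma ae_tendsto_average_trim {Ω₀ : Type*} [MeasurableSpace Ω₀] {P₀ : Measure Ω₀}
    [IsProbabilityMeasure P₀] {X : Ω₀ → ℝ} {Ω : Type*} [MeasurableSpace Ω] {P : Measure Ω}
    [IsProbabilityMeasure P] {Y : ℕ → Ω → ℝ} (hind : iIndepFun Y P)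
    (hid : ∀ s, IdentDistrib (Y s) X P P₀) :
    ∀ᵐ ω ∂P, ∀ α β : ℝ, α ≤ β →
      Tendsto (fun n : ℕ => (∑ s ∈ Finset.range n, trim α β (Y s ω)) / n) atTop
        (𝓝 (∫ ω₀, trim α β (X ω₀) ∂P₀)) := by
  have h1 : ∀ᵐ ω ∂P, ∀ a b : ℚ, Tendsto
      (fun n : ℕ => (∑ s ∈ Finset.range n, max (a : ℝ) (min (b : ℝ) (Y s ω))) / n) atTop
        (𝓝 (∫ ω₀, max (a : ℝ) (min (b : ℝ) (X ω₀)) ∂P₀)) := by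
    rw [ae_all_iff]; intro a
    rw [ae_all_iff]; intro b
    have hm := measurable_clamp (a : ℝ) b
    have h := strong_law_ae_real (μ := P) (fun s ω => max (a : ℝ) (min (b : ℝ) (Y s ω)))
      (integrable_clamp (hid 0).aemeasurable_fst _ _)
      (fun i j hij => (hind.indepFun hij).comp hm hm)
      (fun i => ((hid i).trans (hid 0).symm).comp hm)
    have e := ((hid 0).comp hm).integral_eq
    simp only [Function.comp_def] at e
    rwa [e] at h
  filter_upwards [h1] with ω hω α β hαβ
  simp only [trim_eq_max_min hαβ]
  rw [Metric.tendsto_atTop]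
  intro e he
  -- Countably many rational levels suffice, since the clamp is 1-Lipschitz in its levels. The form
  -- `max a (min b y)` makes sense even if `b < a`.
  obtain ⟨a, ha1, ha2⟩ := exists_rat_btwn (show α < α + e / 3 by linarith)
  obtain ⟨b, hb1, hb2⟩ := exists_rat_btwn (show β < β + e / 3 by linarith)
  have hclose : ∀ y, |max α (min β y) - max (a : ℝ) (min (b : ℝ) y)| ≤ e / 3 := fun y =>
    (abs_max_min_sub_le _ _ _ _ _).trans (max_le (abs_le.2 ⟨by linarith, by linarith⟩)
      (abs_le.2 ⟨by linarith, by linarith⟩))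
  obtain ⟨N, hN⟩ := Metric.tendsto_atTop.1 (hω a b) (e / 3) (by linarith)
  refine ⟨max N 1, fun n hn => ?_⟩
  have hn0 : (0 : ℝ) < n := by exact_mod_cast (le_max_right N 1).trans hn
  have h2 := hN n ((le_max_left N 1).trans hn)
  rw [Real.dist_eq] at h2 ⊢
  have hXm := (hid 0).aemeasurable_snd
  have h3 : |∫ ω₀, max α (min β (X ω₀)) ∂P₀ - ∫ ω₀, max (a : ℝ) (min (b : ℝ) (X ω₀)) ∂P₀|
      ≤ e / 3 := by
    rw [← integral_sub (integrable_clamp hXm _ _) (integrable_clamp hXm _ _), ← Real.norm_eq_abs]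
    have := norm_integral_le_of_norm_le_const (μ := P₀) (C := e / 3)
      (f := fun ω₀ => max α (min β (X ω₀)) - max (a : ℝ) (min (b : ℝ) (X ω₀)))
      (Eventually.of_forall fun ω₀ => hclose _)
    simpa using this
  have h4 : |(∑ s ∈ Finset.range n, max α (min β (Y s ω))) / n
      - (∑ s ∈ Finset.range n, max (a : ℝ) (min (b : ℝ) (Y s ω))) / n| ≤ e / 3 := by
    rw [← sub_div, ← Finset.sum_sub_distrib, abs_div, abs_of_pos hn0, div_le_iff₀ hn0]
    refine (Finset.abs_sum_le_sum_abs _ _).trans ((Finset.sum_le_card_nsmul _ _ (e / 3)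
      fun s _ => hclose _).trans_eq ?_)
    rw [Finset.card_range, nsmul_eq_mul, mul_comm]
  rw [abs_le] at h3 h4
  rw [abs_lt] at h2 ⊢
  constructor <;> linarith

end StrongLaw

/-! ### Convergence along a fixed sample path -/

section Pathwise

variable {V : Type*} [Fintype V] [DecidableEq V] {G : SimpleGraph V} [DecidableRel G.Adj]

lemma eventually_abs_estimate_sub_le (hG : G.Connected) (K t₀ : ℕ) {η α β m ξ : ℝ}
    (hαβ : α ≤ β) {x xt : V → ℕ → ℝ} (hcor : ∀ i, IsCorruption η (x i) (xt i))
    (hlim : ∀ i, Filter.Tendsto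
      (fun n : ℕ => (∑ s ∈ Finset.range n, trim α β (x i (t₀ + s + 1))) / n) Filter.atTop (nhds m))
    (hξ : 0 < ξ) :
    ∀ᶠ t : ℕ in Filter.atTop, ∀ i,
      |estimate G K t₀ α β xt t i - m| ≤ η * (β - α) + ξ := by
  have hclose := consensus_eventually_close hG K (D := β - α) (m := m)
    (c := η * (β - α) + ξ / 2) (u := fun n i => trim α β (xt i (t₀ + n + 1)))
    (v := fun n => (n : ℝ) • estimate G K t₀ α β xt (t₀ + n))
    (fun n i j => by
      linarith [trim_le hαβ (xt i (t₀ + n + 1)), le_trim hαβ (xt j (t₀ + n + 1))])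
    (by simp) (fun n => smul_estimate_succ K t₀ α β xt n) ?_ (half_pos hξ)
  · rw [← Filter.map_add_atTop_eq_nat t₀, Filter.eventually_map]
    filter_upwards [hclose, Filter.eventually_ge_atTop 1] with n hn hn1 i
    have hn0 : (0 : ℝ) < n := by exact_mod_cast hn1
    have h := hn i
    rw [Pi.smul_apply, smul_eq_mul, ← mul_sub, abs_mul, abs_of_pos hn0] at h
    have h' := le_of_mul_le_mul_left h hn0
    rw [add_comm n t₀]
    linarith
  · intro i
    have h1 := (hlim i).eventually (Metric.ball_mem_nhds m (show 0 < ξ / 4 by linarith))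
    -- The corruption budget `η * (t₀ + n)` also counts times up to `t₀`; the excess `η * t₀` is
    -- negligible against `n`.
    obtain ⟨N, hN⟩ := exists_nat_gt ((β - α) * (η * t₀) / (ξ / 4))
    filter_upwards [h1, Filter.eventually_ge_atTop 1, Filter.eventually_ge_atTop N]
      with n hn hn1 hNn
    have hn0 : (0 : ℝ) < n := by exact_mod_cast hn1
    rw [Real.dist_eq, div_sub' hn0.ne', abs_div, abs_of_pos hn0,
      div_lt_iff₀ hn0] at hn
    have h2 := abs_sum_trim_sub_le hαβ (hcor i) t₀ n (by omega)
    have h3 : (β - α) * (η * t₀) ≤ n * (ξ / 4) := by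
      have : (N : ℝ) ≤ n := by exact_mod_cast hNn
      rw [div_lt_iff₀ (by linarith)] at hN
      nlinarith
    push_cast at h2
    rw [abs_le] at h2 ⊢
    rw [abs_lt] at hn
    constructor <;> nlinarith

end Pathwise

/-! ### Locating the empirical quantiles -/

section OrderStat

lemma IsRounding.abs_sub_le {n : ℕ} {r : ℝ} (hr : 0 ≤ r) (h : IsRounding n r) :
    |(n : ℝ) - r| ≤ 1 := by
  rw [abs_le]
  rcases h with rfl | rfl
  · constructor <;> linarith [Nat.floor_le hr, Nat.lt_floor_add_one r]
  · constructor <;> linarith [Nat.le_ceil r, Nat.ceil_lt_add_one hr]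

/-- The margin is `3/16 = 1/8 + 1/16`: corruption changes a count by at most `εN/8`, and rounding
changes a rank by at most `1 ≤ εN/16`. -/
lemma orderStat_mem_of_sampleCount {N a b : ℕ} {ε η : ℝ} (hN : 1 ≤ N) (hεN : 16 ≤ ε * N)
    (hε : ε < 1 / 2) (hηε : 8 * η ≤ ε) (ha : IsRounding a (ε * N))
    (hb : IsRounding b ((1 - ε) * N)) {x y : ℕ → ℝ} (hc : IsCorruption η x y) {q₁ q₂ q₃ q₄ : ℝ}
    (h₁ : sampleCount x N (Set.Iic q₁) < 13 / 16 * (ε * N))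
    (h₂ : 19 / 16 * (ε * N) < sampleCount x N (Set.Iic q₂))
    (h₃ : sampleCount x N (Set.Ioi q₃) < 13 / 16 * (ε * N))
    (h₄ : 19 / 16 * (ε * N) < sampleCount x N (Set.Ioi q₄)) :
    (q₁ < orderStat y N a ∧ orderStat y N a ≤ q₂) ∧
      (q₄ < orderStat y N b ∧ orderStat y N b ≤ q₃) ∧ 1 ≤ a ∧ b ≤ N := by
  have hN0 : (0 : ℝ) < N := by exact_mod_cast hN
  have hεN' : ε * N ≤ N / 2 := by nlinarith
  have ha' := abs_le.1 (ha.abs_sub_le (by linarith))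
  have hb' := abs_le.1 (hb.abs_sub_le (by nlinarith))
  have hηN : η * N ≤ ε * N / 8 := by nlinarith
  have ha1 : 1 ≤ a := by
    have : (0 : ℝ) < a := by linarith
    exact_mod_cast this
  have haN : a ≤ N := by
    have : (a : ℝ) ≤ N := by linarith
    exact_mod_cast this
  have hb1 : 1 ≤ b := by
    have : (0 : ℝ) < b := by linarith
    exact_mod_cast this
  have hbN : b ≤ N := by
    have : (b : ℝ) ≤ N := by linarith
    exact_mod_cast this
  have hcompl := fun q => sampleCount_Iic_add_Ioi y N q
  have hle : ∀ {k : ℕ}, 1 ≤ k → k ≤ N → ∀ q, orderStat y N k ≤ q ↔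
      (k : ℝ) ≤ sampleCount y N (Set.Iic q) := by
    intro k hk hkN q
    rw [orderStat_le_iff y hk hkN, sampleCount_Iic, Nat.cast_le]
  have hxy := fun S => hc.sampleCount_le hN S
  have hyx := fun S => hc.symm.sampleCount_le hN S
  refine ⟨⟨?_, ?_⟩, ⟨?_, ?_⟩, ha1, hbN⟩
  · rw [← not_le, hle ha1 haN, not_le]
    linarith [hxy (Set.Iic q₁)]
  · rw [hle ha1 haN]
    linarith [hyx (Set.Iic q₂)]
  · rw [← not_le, hle hb1 hbN, not_le]
    linarith [hyx (Set.Ioi q₄), hcompl q₄]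
  · rw [hle hb1 hbN]
    linarith [hxy (Set.Ioi q₃), hcompl q₃]

/-- With probability more than `1 - 4 exp (-εN/12)`, the sample counts on four tails of the
distribution allow to locate the empirical quantiles of the corrupted sample. -/
lemma exists_quantile_event {Ω : Type*} [MeasurableSpace Ω] {P : Measure Ω}
    [IsProbabilityMeasure P] {x : ℕ → Ω → ℝ} {ν : Measure ℝ} [IsProbabilityMeasure ν]
    (hν : ν ≪ volume) (hx : ∀ s, AEMeasurable (x (s + 1)) P)
    (hind : iIndepFun (fun s => x (s + 1)) P) (hlaw : ∀ s, P.map (x (s + 1)) = ν)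
    {N a b : ℕ} {ε η : ℝ} (hN : 1 ≤ N) (hεN : 16 ≤ ε * N) (hε0 : 0 < ε)
    (hε : ε < 1 / 2) (hηε : 8 * η ≤ ε) (ha : IsRounding a (ε * N))
    (hb : IsRounding b ((1 - ε) * N)) :
    ∃ F : Set Ω, 1 - 4 * Real.exp (-(ε * N) / 12) ≤ P.real F ∧
      ∀ ω ∈ F, ∀ y : ℕ → ℝ, IsCorruption η (fun s => x s ω) y →
        (ε / 4 ≤ ν.real (Set.Iic (orderStat y N a)) ∧
          ν.real (Set.Iio (orderStat y N a)) ≤ 2 * ε) ∧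
        (ε / 4 ≤ ν.real (Set.Ici (orderStat y N b)) ∧
          ν.real (Set.Ioi (orderStat y N b)) ≤ 2 * ε) ∧ 1 ≤ a ∧ b ≤ N := by
  obtain ⟨q₁, hq₁⟩ := exists_measureReal_Iic_eq ν hν (p := ε / 4) (by linarith) (by linarith)
  obtain ⟨q₂, hq₂⟩ := exists_measureReal_Iic_eq ν hν (p := 2 * ε) (by linarith) (by linarith)
  obtain ⟨q₃, hq₃⟩ := exists_measureReal_Iic_eq ν hν (p := 1 - ε / 4) (by linarith) (by linarith)
  obtain ⟨q₄, hq₄⟩ := exists_measureReal_Iic_eq ν hν (p := 1 - 2 * ε) (by linarith) (by linarith)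
  have hIoi : ∀ q, ν.real (Set.Ioi q) = 1 - ν.real (Set.Iic q) := fun q => by
    rw [← Set.compl_Iic, probReal_compl_eq_one_sub measurableSet_Iic]
  have e₁ := measureReal_le_sampleCount_le hx hind hlaw (measurableSet_Iic (a := q₁)) N hε0.le hq₁
  have e₂ := measureReal_sampleCount_le_le hx hind hlaw (measurableSet_Iic (a := q₂)) N hε0.le hq₂
  have e₃ := measureReal_le_sampleCount_le hx hind hlaw (measurableSet_Ioi (a := q₃)) N hε0.le
    (by rw [hIoi, hq₃]; ring)
  have e₄ := measureReal_sampleCount_le_le hx hind hlaw (measurableSet_Ioi (a := q₄)) N hε0.le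
    (by rw [hIoi, hq₄]; ring)
  set B₁ := {ω | 13 / 16 * (ε * N)
    ≤ sampleCount (fun s => x s ω) N (Set.Iic q₁)} with hB₁
  set B₂ := {ω | sampleCount (fun s => x s ω) N (Set.Iic q₂)
    ≤ 19 / 16 * (ε * N)} with hB₂
  set B₃ := {ω | 13 / 16 * (ε * N)
    ≤ sampleCount (fun s => x s ω) N (Set.Ioi q₃)} with hB₃
  set B₄ := {ω | sampleCount (fun s => x s ω) N (Set.Ioi q₄)
    ≤ 19 / 16 * (ε * N)} with hB₄
  refine ⟨((B₁ ∪ B₂) ∪ (B₃ ∪ B₄))ᶜ, ?_, ?_⟩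
  · have h1 := measureReal_union_le (μ := P) (B₁ ∪ B₂) (B₃ ∪ B₄)
    have h2 := measureReal_union_le (μ := P) B₁ B₂
    have h3 := measureReal_union_le (μ := P) B₃ B₄
    have h4 := measureReal_union_le (μ := P) ((B₁ ∪ B₂) ∪ (B₃ ∪ B₄)) ((B₁ ∪ B₂) ∪ (B₃ ∪ B₄))ᶜ
    rw [Set.union_compl_self, probReal_univ] at h4
    linarith
  · intro ω hω y hy
    simp only [Set.mem_compl_iff, Set.mem_union, not_or] at hω
    obtain ⟨⟨h1, h2⟩, h3, h4⟩ := hω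
    obtain ⟨⟨g1, g2⟩, ⟨g4, g3⟩, g5, g6⟩ := orderStat_mem_of_sampleCount hN hεN hε hηε ha hb hy
      (not_le.1 h1) (not_le.1 h2) (not_le.1 h3) (not_le.1 h4)
    refine ⟨⟨?_, ?_⟩, ⟨?_, ?_⟩, g5, g6⟩
    · rw [← hq₁]
      exact measureReal_mono (Set.Iic_subset_Iic.2 g1.le)
    · rw [← hq₂]
      exact measureReal_mono fun z hz => (le_of_lt hz).trans g2
    · have : ε / 4 = ν.real (Set.Ioi q₃) := by rw [hIoi, hq₃]; ring
      rw [this]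
      exact measureReal_mono fun z hz => g3.trans (le_of_lt hz)
    · have : 2 * ε = ν.real (Set.Ioi q₄) := by rw [hIoi, hq₄]; ring
      rw [this]
      exact measureReal_mono (Set.Ioi_subset_Ioi g4.le)

end OrderStat

/-- An event of probability more than `c` on which `p t` holds eventually yields `p t` with
probability at least `c` for all large `t`. -/
lemma exists_forall_le_measureReal_of_eventually {Ω : Type*} [MeasurableSpace Ω] {P : Measure Ω}
    [IsProbabilityMeasure P] {F : Set Ω} {c : ℝ} (hF : c < P.real F) {p : ℕ → Ω → Prop}
    (hp : ∀ᵐ ω ∂P, ω ∈ F → ∀ᶠ t in Filter.atTop, p t ω) :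
    ∃ T : ℕ, ∀ t, T ≤ t → c ≤ P.real {ω | p t ω} := by
  set S : ℕ → Set Ω := fun T => {ω | ∀ t, T ≤ t → p t ω} with hS
  have hmono : Monotone S := fun T T' hT ω hω t ht => hω t (hT.trans ht)
  -- Almost every point of `F` lies in some `S T`, and continuity from below holds for increasing
  -- sets without measurability.
  have hFS : P F ≤ P (⋃ T, S T) := measure_mono_ae (by
    filter_upwards [hp] with ω hω hωF
    obtain ⟨T, hT⟩ := Filter.eventually_atTop.1 (hω hωF)
    exact Set.mem_iUnion.2 ⟨T, hT⟩)
  have hlim := (ENNReal.tendsto_toReal (measure_ne_top P (⋃ T, S T))).comp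
    (tendsto_measure_iUnion_atTop (μ := P) hmono)
  have hlt : c < (P (⋃ T, S T)).toReal :=
    hF.trans_le (ENNReal.toReal_mono (measure_ne_top _ _) hFS)
  obtain ⟨T, hT⟩ := (hlim.eventually (lt_mem_nhds hlt)).exists
  exact ⟨T, fun t ht => (le_of_lt hT).trans (measureReal_mono fun ω hω => hω t ht)⟩

end RobustMean

/-! ### Assembly of the estimates -/

open RobustMean in
theorem corollary3
    -- the communication network
    {V : Type*} [Fintype V] [DecidableEq V]
    (G : SimpleGraph V) [DecidableRel G.Adj] (hG : G.Connected)
    -- the random variable to be estimated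
    {Ω₀ : Type*} [MeasurableSpace Ω₀] (P₀ : Measure Ω₀) [IsProbabilityMeasure P₀]
    (X : Ω₀ → ℝ) (hX : MemLp X 2 P₀) (hXac : P₀.map X ≪ volume)
    -- the original data of all agents at the times 1, 2, …: i.i.d. copies of X
    {Ω : Type*} [MeasurableSpace Ω] (P : Measure Ω) [IsProbabilityMeasure P]
    (x : V → ℕ → Ω → ℝ)
    (hxind : iIndepFun (fun p : V × ℕ => x p.1 (p.2 + 1)) P)
    (hxid : ∀ i : V, ∀ t : ℕ, 1 ≤ t → IdentDistrib (x i t) X P P₀)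
    -- the data after corruption by an adversary who sees everything
    (η : ℝ) (hη : 0 < η) (hη' : η < 1 / 16)
    (xt : V → ℕ → Ω → ℝ) (hxt : ∀ (i : V) (t : ℕ), AEMeasurable (xt i t) P)
    (hcor : ∀ᵐ ω ∂P, ∀ i : V, IsCorruption η (fun t => x i t ω) (fun t => xt i t ω))
    -- initialization time and confidence level
    (t₀ : ℕ) (ht₀ : 1 ≤ t₀) (δ : ℝ) (hδ : 0 < δ) (hδ' : δ < 1)
    (hδt : ∀ t : ℕ, 2 * t₀ ≤ t → 4 * Real.exp (-((t : ℝ) - t₀)) ≤ δ)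
    (hε : trimLevel η δ t₀ < 1 / 2)
    -- the agent o whose trimming values are used, and the (rounded) ranks of these values
    (o : V) (a b : ℕ) (ha : IsRounding a (trimLevel η δ t₀ * t₀))
    (hb : IsRounding b ((1 - trimLevel η δ t₀) * t₀)) (hab : a ≤ b)
    -- the number of communication rounds per time step; no restriction on K is needed
    (K : ℕ) :
    ∀ ξ : ℝ, 0 < ξ → ∃ tbar : ℕ, ∀ t : ℕ, tbar ≤ t →
      1 - δ ≤ P.real {ω | ∀ i : V,
        |estimate G K t₀ (orderStat (fun s => xt o s ω) t₀ a) (orderStat (fun s => xt o s ω) t₀ b)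
            (fun j s => xt j s ω) t i - ∫ ω₀, X ω₀ ∂P₀|
          ≤ 24 * √(variance X P₀) * √(4 * η + 6 * (Real.log (4 / δ) / t₀)) + ξ} := by
  intro ξ hξ
  set L := Real.log (4 / δ) with hL
  set ε := trimLevel η δ t₀ with hεdef
  have ht₀' : (0 : ℝ) < t₀ := by exact_mod_cast ht₀
  have hεL : ε = 8 * η + 12 * (L / t₀) := rfl
  have hεN : ε * t₀ = 8 * η * t₀ + 12 * L := by rw [hεL]; field_simp
  -- This yields `ε * t₀ ≥ 12 * L ≥ 16`, the sample size that absorbs rounding.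
  have hLlow : 4 / 3 < L := by
    have h1 : Real.log 4 ≤ L := Real.log_le_log (by norm_num) (by
      rw [le_div_iff₀ hδ]; linarith)
    have h2 : Real.log 4 = 2 * Real.log 2 := by
      rw [show (4 : ℝ) = 2 ^ 2 by norm_num, Real.log_pow]; norm_num
    linarith [Real.log_two_gt_d9]
  have hLt : 0 < L / t₀ := by positivity
  have hηt : 0 < η * t₀ := by positivity
  have hε0 : 0 < ε := by linarith
  have hind : ∀ i, iIndepFun (fun s => x i (s + 1)) P := fun i =>
    hxind.precomp (g := fun s : ℕ => (i, s)) fun s s' h => (Prod.mk.inj h).2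
  have hid : ∀ i s, IdentDistrib (x i (s + 1)) X P P₀ := fun i s => hxid i _ (by omega)
  have hXm := hX.aestronglyMeasurable.aemeasurable
  have : IsProbabilityMeasure (P₀.map X) := Measure.isProbabilityMeasure_map hXm
  obtain ⟨F, hF, hFω⟩ := exists_quantile_event (P := P) (x := x o) (η := η) hXac
    (fun s => (hid o s).aemeasurable_fst) (hind o) (fun s => (hid o s).map_eq) ht₀
    (by linarith) hε0 hε (by linarith) ha hb
  have hF' : 1 - δ < P.real F := by
    refine lt_of_lt_of_le ?_ hF
    -- Strict because `ε * t₀ / 12` exceeds `L` by a positive multiple of `η * t₀`; and `4 * exp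
    -- (-L) = δ`.
    have h1 : Real.exp (-(ε * t₀) / 12) < Real.exp (-L) := Real.exp_lt_exp.2 (by linarith)
    rw [Real.exp_neg, hL, Real.exp_log (by positivity), inv_div] at h1
    linarith
  have hslln : ∀ᵐ ω ∂P, ∀ i : V, ∀ α β : ℝ, α ≤ β → Filter.Tendsto
      (fun n : ℕ => (∑ s ∈ Finset.range n, trim α β (x i (t₀ + s + 1) ω)) / n) Filter.atTop
        (nhds (∫ ω₀, trim α β (X ω₀) ∂P₀)) := by
    rw [ae_all_iff]
    exact fun i => ae_tendsto_average_trim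
      ((hind i).precomp (g := fun s : ℕ => t₀ + s) fun s s' h => by simpa using h)
      fun s => hid i _
  refine exists_forall_le_measureReal_of_eventually hF' ?_
  filter_upwards [hcor, hslln] with ω hω hlim hωF
  obtain ⟨⟨h1, h2⟩, ⟨h3, h4⟩, ha1, hbN⟩ := hFω ω hωF _ (hω o)
  set α := orderStat (fun s => xt o s ω) t₀ a
  set β := orderStat (fun s => xt o s ω) t₀ b
  have hαβ : α ≤ β := orderStat_mono _ ha1 hab hbN
  obtain ⟨b1, b2⟩ := bias_trim_le hX hαβ hε0 h1 h2 h3 h4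
  filter_upwards [eventually_abs_estimate_sub_le hG K t₀ hαβ hω (fun i => hlim i α β hαβ) hξ]
    with t ht i
  -- Here `ε` is twice the radicand and `√2 ≤ 3/2`. Bias `10σ√ε` and corruption `σ√ε/2` then total
  -- at most `15.75 ≤ 24` times `σ` times this root.
  have hsqrt : √ε ≤ 3 / 2 * √(4 * η + 6 * (L / t₀)) := by
    refine Real.sqrt_le_iff.2 ⟨by positivity, ?_⟩
    rw [mul_pow, Real.sq_sqrt (by positivity)]
    linarith
  have hη8 : η * (β - α) ≤ (β - α) * ε / 8 := by nlinarith
  have hσ := mul_le_mul_of_nonneg_left hsqrt (Real.sqrt_nonneg (variance X P₀))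
  have hσ0 : 0 ≤ √(variance X P₀) * √(4 * η + 6 * (L / t₀)) := by positivity
  have habs := abs_sub_le (estimate G K t₀ α β (fun j s => xt j s ω) t i)
    (∫ ω₀, trim α β (X ω₀) ∂P₀) (∫ ω₀, X ω₀ ∂P₀)
  linarith [ht i]
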